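/- Let $k,n,d\in\mathbb{N}$ with $n\ge k\ge 2$, let $X=\{x_1,\dots,x_n\}\subset\mathbb{R}^d$ be a set of $n$ distinct points with weights $\omega_1,\dots,\omega_n>0$, and let $\kappa^-,\kappa^+\in\mathbb{R}^k$ satisfy $0<\kappa_i^-\le\kappa_i^+$ for all $i\le k$ and $\sum_{i}\kappa_i^-\le\sum_{j}\omega_j\le\sum_i\kappa_i^+$. Let $V$ be a real inner-product space of finite dimension $d_\varphi$, let $\varphi:\mathbb{R}^d\to V$ be a map, and let $s_1,\dots,s_k\in\mathbb{R}^d$ be (not necessarily distinct) initial sites. Let $\mathcal{P}$ be the polytope of all $y=(y_{ij})\in\mathbb{R}^{k\times n}$ with $y_{ij}\ge 0$, $\sum_{i=1}^k y_{ij}=1$ for all $j\le n$, and $\kappa_i^-\le\sum_{j=1}^n y_{ij}\omega_j\le\kappa_i^+$ for all $i\le k$. Weight-balanced kernel $k$-means starts with the sites $s_i^{(1)}:=\varphi(s_i)\in V$ $(i\le k)$, and its $l$-th iteration $(l=1,2,\dots)$ consists of two steps. 1. Compute a basic optimal solution (a vertex of $\mathcal{P}$) $y^{(l)}$ of the linear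 program $$\Theta^{(l)}:=\min_{y\in\mathcal{P}}\ \sum_{i=1}^k\sum_{j=1}^n \omega_j\,y_{ij}\left(\langle s_i^{(l)},s_i^{(l)}\rangle-2\langle\varphi(x_j),s_i^{(l)}\rangle\right);$$ if there are several, any of them may be chosen. 2. Update the sites to the centers of gravity $$s_i^{(l+1)}:=\frac{1}{\sum_{j=1}^n y^{(l)}_{ij}\omega_j}\sum_{j=1}^n y^{(l)}_{ij}\,\omega_j\,\varphi(x_j)\qquad(i\le k).$$ If $l=1$ or $\Theta^{(l)}<\Theta^{(l-1)}$, continue with iteration $l+1$; otherwise return the current assignment and sites. Then every iteration can be carried out, and every execution of the algorithm terminates after at most $$(40\,e\,k^2\,n)^{(d_\varphi+1)k-1}$$ iterations, where $e$ is Euler's number. -/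

import Mathlib

namespace WeightBalancedKernelKMeans

noncomputable section

/-- The size `|C_i| = ∑_j y_ij ω_j` of the `i`-th cluster of the assignment `y`. -/
def clusterSize {k n : ℕ} (ω : Fin n → ℝ) (y : Fin k → Fin n → ℝ) (i : Fin k) : ℝ :=
  ∑ j, y i j * ω j

/-- The weight-balanced partition polytope: the assignment vectors of the clusterings
with `κ⁻ ≤ |C| ≤ κ⁺`. -/
def partitionPolytope {k n : ℕ} (ω : Fin n → ℝ) (κlo κhi : Fin k → ℝ) :
    Set (Fin k → Fin n → ℝ) :=
  {y | (∀ i, κlo i ≤ clusterSize ω y i ∧ clusterSize ω y i ≤ κhi i) ∧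
    (∀ j, ∑ i, y i j = 1) ∧ ∀ i j, 0 ≤ y i j}

variable {V : Type*} [NormedAddCommGroup V] [InnerProductSpace ℝ V]

/-- The objective function `∑_i ∑_j ω_j y_ij (⟨s_i, s_i⟩ - 2 ⟨p_j, s_i⟩)` for points `p_j`
and sites `s_i` in the feature space. -/
def objective {k n : ℕ} (ω : Fin n → ℝ) (p : Fin n → V) (s : Fin k → V)
    (y : Fin k → Fin n → ℝ) : ℝ :=
  ∑ i, ∑ j, ω j * y i j * (inner ℝ (s i) (s i) - 2 * inner ℝ (p j) (s i))

/-- The center of gravity of the `i`-th cluster in the feature space. -/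
def center {k n : ℕ} (ω : Fin n → ℝ) (p : Fin n → V) (y : Fin k → Fin n → ℝ)
    (i : Fin k) : V :=
  (clusterSize ω y i)⁻¹ • ∑ j, (y i j * ω j) • p j

/-- `y` is a possible output of the weight-balanced kernel least-squares assignment for the
sites `s`: an optimal basic feasible solution (that is, an optimal vertex) of the linear program
that minimizes the objective function over the partition polytope. -/
structure IsAssignment {k n : ℕ} (ω : Fin n → ℝ) (κlo κhi : Fin k → ℝ) (p : Fin n → V)
    (s : Fin k → V) (y : Fin k → Fin n → ℝ) : Prop where
  vertex : y ∈ Set.extremePoints ℝ (partitionPolytope ω κlo κhi)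
  optimal : ∀ y' ∈ partitionPolytope ω κlo κhi, objective ω p s y ≤ objective ω p s y'

/-- `S` and `y` record the first `T` iterations of an execution of weight-balanced kernel
`k`-means with feature map `φ`, data points `x` and initial sites `s`. The iterations are numbered
from `0`; iteration `l` computes the assignment `y l` for the sites `S l`, and then replaces the
sites by the centers of gravity `S (l + 1)`. Entries beyond these iterations are irrelevant.
The algorithm goes on after iteration `l + 1` only if the objective value decreased compared with
iteration `l`; after iteration `0` there is no earlier value, and it always goes on. -/
structure IsExecution {k n d : ℕ} (ω : Fin n → ℝ) (κlo κhi : Fin k → ℝ)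
    (φ : EuclideanSpace ℝ (Fin d) → V) (x : Fin n → EuclideanSpace ℝ (Fin d))
    (s : Fin k → EuclideanSpace ℝ (Fin d))
    (T : ℕ) (S : ℕ → Fin k → V) (y : ℕ → Fin k → Fin n → ℝ) : Prop where
  init : ∀ i, S 0 i = φ (s i)
  assign : ∀ l < T, IsAssignment ω κlo κhi (fun j => φ (x j)) (S l) (y l)
  update : ∀ l < T, ∀ i, S (l + 1) i = center ω (fun j => φ (x j)) (y l) i
  goOn : ∀ l, l + 2 < T →
    objective ω (fun j => φ (x j)) (S (l + 1)) (y (l + 1)) <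
      objective ω (fun j => φ (x j)) (S l) (y l)

/-- The execution returns its result after `T` iterations: the last of them did not decrease the
objective value. -/
def HasReturned {k n : ℕ} (ω : Fin n → ℝ) (p : Fin n → V)
    (T : ℕ) (S : ℕ → Fin k → V) (y : ℕ → Fin k → Fin n → ℝ) : Prop :=
  ∃ l, T = l + 2 ∧ ¬ objective ω p (S (l + 1)) (y (l + 1)) < objective ω p (S l) (y l)

end

end WeightBalancedKernelKMeans

/-! ### Linear programming duality for the assignment step. -/

namespace WeightBalancedKernelKMeans

open Filter Topology

/-! The iterations are counted by combinatorial certificates of optimality. By Farkas' lemma an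
optimal assignment has multipliers `β` of the size constraints satisfying complementary slackness
(`exists_isComplementary`), which conversely implies optimality (`IsComplementary.costLinear_le`).
Slackness sees sites and multipliers only through the signs of `β` and of the differences of reduced
costs (`IsComplementary.congr`).

There are at most `3 ^ k` sign vectors of `β`. The reduced costs become linear once `⟨s_i, s_i⟩ -
β_i` is treated as an independent coordinate, and only differences matter, so one such coordinate
can be set to zero. Their signs thus label cells of a central arrangement of `k * k * n` functionals
in dimension at most `N = (finrank ℝ V + 1) * k - 1`, and `ncard_signPatterns_le` bounds the number
of cells.

If iterations `l` and `m > l + 1` shared a certificate, `y l` would be optimal for `S m`. Centers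
being optimal sites, this contradicts the strict decrease of the objective
(`IsExecution.not_optimal`). Hence the even iterations have distinct certificates, which bounds `T /
2`. -/

/-- **Farkas' lemma**: a linear functional that is nonnegative wherever finitely many functionals
are nonnegative is a conic combination of them. -/
theorem exists_conic_combination {W : Type*} [AddCommGroup W] [Module ℝ W] :
    ∀ {m : ℕ} (a : Fin m → W →ₗ[ℝ] ℝ) (c : W →ₗ[ℝ] ℝ),
      (∀ x, (∀ i, 0 ≤ a i x) → 0 ≤ c x) →
      ∃ r : Fin m → ℝ, (∀ i, 0 ≤ r i) ∧ ∀ x, c x = ∑ i, r i * a i x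
  | 0, a, c, h => by
    refine ⟨fun _ => 0, fun _ => le_rfl, fun x => ?_⟩
    have h1 := h x (fun i => i.elim0)
    have h2 := h (-x) (fun i => i.elim0)
    rw [map_neg] at h2
    simp only [Finset.univ_eq_empty, Finset.sum_empty]
    linarith
  | m + 1, a, c, h => by
    by_cases hc : ∀ x, (∀ i : Fin m, 0 ≤ a i.succ x) → 0 ≤ c x
    · obtain ⟨r, hr, hcr⟩ := exists_conic_combination (fun i : Fin m => a i.succ) c hc
      refine ⟨Fin.cons 0 r, Fin.cases le_rfl hr, fun x => ?_⟩
      simp [Fin.sum_univ_succ, hcr x]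
    · push Not at hc
      obtain ⟨u, hu, hcu⟩ := hc
      have hbu : a 0 u < 0 := by
        by_contra hb
        exact absurd (h u (Fin.cases (not_lt.mp hb) hu)) (not_le.mpr hcu)
      -- Compose all functionals with the projection onto the kernel of `a 0` along `u`. The first
      -- hypothesis then holds with equality and the induction applies to the other `m`.
      obtain ⟨r, hr, hcr⟩ := exists_conic_combination
        (fun i : Fin m => a i.succ - (a i.succ u / a 0 u) • a 0) (c - (c u / a 0 u) • a 0) (by
          intro x hx
          have key : ∀ f : W →ₗ[ℝ] ℝ, f (x - (a 0 x / a 0 u) • u) = f x - f u / a 0 u * a 0 x := by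
            intro f
            simp only [map_sub, map_smul, smul_eq_mul]
            ring
          have := h (x - (a 0 x / a 0 u) • u) (by
            refine Fin.cases ?_ fun i => ?_
            · rw [key, div_self hbu.ne, one_mul, sub_self]
            · rw [key]
              simpa using hx i)
          rw [key] at this
          simpa using this)
      refine ⟨Fin.cons (c u / a 0 u - ∑ i, r i * (a i.succ u / a 0 u)) r, ?_, fun x => ?_⟩
      · refine Fin.cases ?_ hr
        have h1 : 0 ≤ c u / a 0 u := div_nonneg_of_nonpos hcu.le hbu.le
        have h2 : ∑ i, r i * (a i.succ u / a 0 u) ≤ 0 := Finset.sum_nonpos fun i _ =>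
          mul_nonpos_of_nonneg_of_nonpos (hr i) (div_nonpos_of_nonneg_of_nonpos (hu i) hbu.le)
        simp only [Fin.cons_zero]
        linarith
      · have h3 := hcr x
        simp only [LinearMap.sub_apply, LinearMap.smul_apply, smul_eq_mul, mul_sub,
          Finset.sum_sub_distrib] at h3
        simp only [Fin.sum_univ_succ, Fin.cons_zero, Fin.cons_succ, sub_mul, Finset.sum_mul]
        simp only [← mul_assoc] at h3 ⊢
        linarith

theorem exists_conic_combination_of_fintype {W ι : Type*} [AddCommGroup W] [Module ℝ W]
    [Fintype ι] (a : ι → W →ₗ[ℝ] ℝ) (c : W →ₗ[ℝ] ℝ)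
    (h : ∀ x, (∀ i, 0 ≤ a i x) → 0 ≤ c x) :
    ∃ r : ι → ℝ, (∀ i, 0 ≤ r i) ∧ ∀ x, c x = ∑ i, r i * a i x := by
  let e := Fintype.equivFin ι
  obtain ⟨r, hr, hcr⟩ := exists_conic_combination (fun i => a (e.symm i)) c
    fun x hx => h x fun i => by simpa using hx (e i)
  refine ⟨fun i => r (e i), fun i => hr _, fun x => ?_⟩
  rw [hcr x, ← e.sum_comp]
  simp

/-- The size of a cluster as a linear functional of the assignment. -/
def clusterSizeLinear {k n : ℕ} (ω : Fin n → ℝ) (i : Fin k) : (Fin k → Fin n → ℝ) →ₗ[ℝ] ℝ where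
  toFun y := clusterSize ω y i
  map_add' y z := by simp [clusterSize, add_mul, Finset.sum_add_distrib]
  map_smul' c y := by simp [clusterSize, Finset.mul_sum, mul_assoc]

/-- The total share of the `j`-th point as a linear functional of the assignment. -/
def shareLinear {k n : ℕ} (j : Fin n) : (Fin k → Fin n → ℝ) →ₗ[ℝ] ℝ where
  toFun y := ∑ i, y i j
  map_add' y z := by simp [Finset.sum_add_distrib]
  map_smul' c y := by simp [Finset.mul_sum]

/-- A single entry as a linear functional of the assignment. -/
def entryLinear {k n : ℕ} (i : Fin k) (j : Fin n) : (Fin k → Fin n → ℝ) →ₗ[ℝ] ℝ where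
  toFun y := y i j
  map_add' _ _ := rfl
  map_smul' _ _ := rfl

/-- The transport cost `∑_i ∑_j ω_j y_ij g_ij` as a linear functional of the assignment. -/
def costLinear {k n : ℕ} (ω : Fin n → ℝ) (g : Fin k → Fin n → ℝ) :
    (Fin k → Fin n → ℝ) →ₗ[ℝ] ℝ where
  toFun y := ∑ i, ∑ j, ω j * y i j * g i j
  map_add' y z := by simp [mul_add, add_mul, Finset.sum_add_distrib]
  map_smul' c y := by
    simp only [Pi.smul_apply, smul_eq_mul, Finset.mul_sum, RingHom.id_apply]
    exact Finset.sum_congr rfl fun i _ => Finset.sum_congr rfl fun j _ => by ring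

theorem entryLinear_single {k n : ℕ} (i : Fin k) (j : Fin n) (q : Fin k × Fin n) :
    entryLinear q.1 q.2 (Pi.single i (Pi.single j 1)) = if q = (i, j) then 1 else 0 := by
  obtain ⟨i', j'⟩ := q
  change (Pi.single i (Pi.single j 1) : Fin k → Fin n → ℝ) i' j' = _
  by_cases hi : i' = i
  · subst hi
    simp [Pi.single_apply]
  · simp [hi]

theorem shareLinear_single {k n : ℕ} (i : Fin k) (j j' : Fin n) :
    shareLinear j' (Pi.single i (Pi.single j 1) : Fin k → Fin n → ℝ) =
      if j' = j then 1 else 0 := by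
  change ∑ i', (Pi.single i (Pi.single j 1) : Fin k → Fin n → ℝ) i' j' = _
  rw [Finset.sum_eq_single i (fun i' _ h => by simp [h]) (by simp)]
  simp [Pi.single_apply]

theorem clusterSizeLinear_single {k n : ℕ} (ω : Fin n → ℝ) (i i' : Fin k) (j : Fin n) :
    clusterSizeLinear ω i' (Pi.single i (Pi.single j 1)) = if i' = i then ω j else 0 := by
  change ∑ j', (Pi.single i (Pi.single j 1) : Fin k → Fin n → ℝ) i' j' * ω j' = _
  by_cases hi : i' = i
  · subst hi
    simp [Pi.single_apply]
  · simp [hi]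

theorem costLinear_single {k n : ℕ} (ω : Fin n → ℝ) (g : Fin k → Fin n → ℝ) (i : Fin k)
    (j : Fin n) : costLinear ω g (Pi.single i (Pi.single j 1)) = ω j * g i j := by
  change ∑ i', ∑ j', ω j' * (Pi.single i (Pi.single j 1) : Fin k → Fin n → ℝ) i' j' * g i' j' = _
  rw [Finset.sum_eq_single i (fun i' _ h => by simp [h]) (by simp)]
  simp [Pi.single_apply]

/-- Complementary slackness of the assignment `y` and the multipliers `β` of the size constraints
for the cost coefficients `g`. -/
structure IsComplementary {k n : ℕ} (ω : Fin n → ℝ) (κlo κhi : Fin k → ℝ)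
    (g : Fin k → Fin n → ℝ) (β : Fin k → ℝ) (y : Fin k → Fin n → ℝ) : Prop where
  support : ∀ i j, 0 < y i j → ∀ i', g i j - β i ≤ g i' j - β i'
  lower : ∀ i, 0 < β i → clusterSize ω y i = κlo i
  upper : ∀ i, β i < 0 → clusterSize ω y i = κhi i

/-- A slack constraint survives a small step, so only a tight one restricts the direction. The
filter form lets finitely many constraints share one step length. -/
theorem eventually_nonneg_add_mul {a b : ℝ} (ha : 0 ≤ a) (hb : a = 0 → 0 ≤ b) :
    ∀ᶠ ε : ℝ in 𝓝[>] 0, 0 ≤ a + ε * b := by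
  rcases ha.eq_or_lt with h | h
  · filter_upwards [self_mem_nhdsWithin] with ε hε
    rw [← h, zero_add]
    exact mul_nonneg (le_of_lt hε) (hb h.symm)
  · have hc : Tendsto (fun ε : ℝ => a + ε * b) (𝓝[>] 0) (𝓝 (a + 0 * b)) :=
      (Continuous.tendsto (by fun_prop) 0).mono_left nhdsWithin_le_nhds
    rw [zero_mul, add_zero] at hc
    exact (hc.eventually (lt_mem_nhds h)).mono fun _ h => h.le

variable {k n : ℕ} {ω : Fin n → ℝ} {κlo κhi : Fin k → ℝ} {g : Fin k → Fin n → ℝ}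
  {y : Fin k → Fin n → ℝ}

/-- The cost does not decrease along a feasible direction of an optimal assignment. -/
theorem costLinear_nonneg_of_feasible_direction (hy : y ∈ partitionPolytope ω κlo κhi)
    (hopt : ∀ y' ∈ partitionPolytope ω κlo κhi, costLinear ω g y ≤ costLinear ω g y')
    {z : Fin k → Fin n → ℝ} (hz : ∀ i j, y i j = 0 → 0 ≤ z i j) (hcol : ∀ j, ∑ i, z i j = 0)
    (hlo : ∀ i, clusterSize ω y i = κlo i → 0 ≤ clusterSize ω z i)
    (hhi : ∀ i, clusterSize ω y i = κhi i → clusterSize ω z i ≤ 0) :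
    0 ≤ costLinear ω g z := by
  have h1 : ∀ᶠ ε : ℝ in 𝓝[>] 0, ∀ i j, 0 ≤ y i j + ε * z i j :=
    eventually_all.2 fun i => eventually_all.2 fun j =>
      eventually_nonneg_add_mul (hy.2.2 i j) (hz i j)
  have h2 : ∀ᶠ ε : ℝ in 𝓝[>] 0, ∀ i,
      0 ≤ (clusterSize ω y i - κlo i) + ε * clusterSize ω z i :=
    eventually_all.2 fun i => eventually_nonneg_add_mul (sub_nonneg.2 (hy.1 i).1)
      fun h => hlo i (sub_eq_zero.1 h)
  have h3 : ∀ᶠ ε : ℝ in 𝓝[>] 0, ∀ i,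
      0 ≤ (κhi i - clusterSize ω y i) + ε * -clusterSize ω z i :=
    eventually_all.2 fun i => eventually_nonneg_add_mul (sub_nonneg.2 (hy.1 i).2)
      fun h => neg_nonneg.2 (hhi i (sub_eq_zero.1 h).symm)
  obtain ⟨ε, ⟨⟨h1, h2⟩, h3⟩, hε⟩ := (((h1.and h2).and h3).and self_mem_nhdsWithin).exists
  have hε : 0 < ε := hε
  have hsize : ∀ i, clusterSize ω (y + ε • z) i = clusterSize ω y i + ε * clusterSize ω z i := by
    intro i
    have := map_add (clusterSizeLinear ω i) y (ε • z)
    rwa [map_smul] at this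
  have hmem : y + ε • z ∈ partitionPolytope ω κlo κhi := by
    refine ⟨fun i => ?_, fun j => ?_, fun i j => h1 i j⟩
    · rw [hsize]
      constructor
      · linarith [h2 i]
      · linarith [h3 i]
    · have := map_add (shareLinear j) y (ε • z)
      rw [map_smul] at this
      refine this.trans ?_
      change ∑ i, y i j + ε * ∑ i, z i j = 1
      rw [hy.2.1, hcol, mul_zero, add_zero]
  have := hopt _ hmem
  rw [map_add, map_smul, smul_eq_mul] at this
  exact nonneg_of_mul_nonneg_right (by linarith) hε

/-- An optimal assignment has multipliers of the size constraints. -/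
theorem exists_isComplementary (hω : ∀ j, 0 < ω j) (hy : y ∈ partitionPolytope ω κlo κhi)
    (hopt : ∀ y' ∈ partitionPolytope ω κlo κhi, costLinear ω g y ≤ costLinear ω g y') :
    ∃ β, IsComplementary ω κlo κhi g β y := by
  classical
  -- Inactive constraints enter as the zero functional, which keeps the index type fixed; each
  -- column equation enters as two inequalities.
  obtain ⟨r, hr, hcr⟩ := exists_conic_combination_of_fintype
    (ι := (Fin k × Fin n) ⊕ (Fin n ⊕ Fin n) ⊕ (Fin k ⊕ Fin k))
    (Sum.elim (fun q => if y q.1 q.2 = 0 then entryLinear q.1 q.2 else 0)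
      (Sum.elim (Sum.elim (fun j => shareLinear j) (fun j => -shareLinear j))
        (Sum.elim (fun i => if clusterSize ω y i = κlo i then clusterSizeLinear ω i else 0)
          (fun i => if clusterSize ω y i = κhi i then -clusterSizeLinear ω i else 0))))
    (costLinear ω g) (by
      intro z hz
      refine costLinear_nonneg_of_feasible_direction hy hopt ?_ ?_ ?_ ?_
      · intro i j h
        have h1 := hz (.inl (i, j))
        simp only [Sum.elim_inl, if_pos h] at h1
        exact h1
      · intro j
        have h1 := hz (.inr (.inl (.inl j)))
        have h2 := hz (.inr (.inl (.inr j)))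
        simp only [Sum.elim_inr, Sum.elim_inl, LinearMap.neg_apply] at h1 h2
        change 0 ≤ ∑ i, z i j at h1
        change 0 ≤ -∑ i, z i j at h2
        linarith
      · intro i h
        have h1 := hz (.inr (.inr (.inl i)))
        simp only [Sum.elim_inr, Sum.elim_inl, if_pos h] at h1
        exact h1
      · intro i h
        have h1 := hz (.inr (.inr (.inr i)))
        simp only [Sum.elim_inr, if_pos h, LinearMap.neg_apply] at h1
        exact neg_nonneg.1 h1)
  let lo : Fin k → ℝ := fun i => if clusterSize ω y i = κlo i then r (.inr (.inr (.inl i))) else 0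
  let hi : Fin k → ℝ := fun i => if clusterSize ω y i = κhi i then r (.inr (.inr (.inr i))) else 0
  let α : Fin n → ℝ := fun j => r (.inr (.inl (.inl j))) - r (.inr (.inl (.inr j)))
  let ρ : Fin k → Fin n → ℝ := fun i j => if y i j = 0 then r (.inl (i, j)) else 0
  have hlo : ∀ i, 0 ≤ lo i := fun i => by dsimp only [lo]; split_ifs; exacts [hr _, le_rfl]
  have hhi : ∀ i, 0 ≤ hi i := fun i => by dsimp only [hi]; split_ifs; exacts [hr _, le_rfl]
  have hρ : ∀ i j, 0 ≤ ρ i j := fun i j => by dsimp only [ρ]; split_ifs; exacts [hr _, le_rfl]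
  -- Evaluate the conic combination at matrix units. Since `α j` does not depend on `i` and `ρ`
  -- vanishes on the support of `y`, the reduced cost is minimal there.
  have key : ∀ i j, ω j * (g i j - (lo i - hi i)) = ρ i j + α j := by
    intro i j
    have h := hcr (Pi.single i (Pi.single j 1))
    have he : ∀ (p : Prop) [Decidable p] (a : ℝ) (F : (Fin k → Fin n → ℝ) →ₗ[ℝ] ℝ) z,
        a * (if p then F else 0) z = (if p then a else 0) * F z := by
      intro p _ a F z
      split_ifs <;> simp
    simp only [Fintype.sum_sum_type, Sum.elim_inl, Sum.elim_inr, he, LinearMap.neg_apply,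
      costLinear_single, shareLinear_single, entryLinear_single, clusterSizeLinear_single,
      mul_neg, mul_ite, mul_one, mul_zero, Finset.sum_neg_distrib, Finset.sum_ite_eq',
      Finset.mem_univ, if_true] at h
    change _ = ρ i j + (r _ + -r _ + (lo i * ω j + -(hi i * ω j))) at h
    dsimp only [α]
    linarith
  refine ⟨fun i => lo i - hi i, ?_, ?_, ?_⟩
  · intro i j hij i'
    have h1 := key i j
    have h2 := key i' j
    have h3 : ρ i j = 0 := if_neg hij.ne'
    refine le_of_mul_le_mul_left ?_ (hω j)
    rw [h1, h2, h3]
    linarith [hρ i' j]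
  · intro i h
    by_contra hne
    have : lo i = 0 := if_neg hne
    linarith [hhi i]
  · intro i h
    by_contra hne
    have : hi i = 0 := if_neg hne
    linarith [hlo i]

/-- Complementary slackness implies optimality. -/
theorem IsComplementary.costLinear_le {β : Fin k → ℝ} (h : IsComplementary ω κlo κhi g β y)
    (hω : ∀ j, 0 < ω j) (hy : y ∈ partitionPolytope ω κlo κhi) {y' : Fin k → Fin n → ℝ}
    (hy' : y' ∈ partitionPolytope ω κlo κhi) : costLinear ω g y ≤ costLinear ω g y' := by
  -- Lagrangian splitting: `y` minimizes the reduced costs point by point, and the size term cluster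
  -- by cluster.
  have split : ∀ u : Fin k → Fin n → ℝ, costLinear ω g u =
      ∑ j, ω j * ∑ i, u i j * (g i j - β i) + ∑ i, β i * clusterSize ω u i := by
    intro u
    change ∑ i, ∑ j, ω j * u i j * g i j = _
    simp only [clusterSize, Finset.mul_sum]
    rw [Finset.sum_comm (γ := Fin n), ← Finset.sum_add_distrib]
    refine Finset.sum_congr rfl fun i _ => ?_
    rw [← Finset.sum_add_distrib]
    exact Finset.sum_congr rfl fun j _ => by ring
  rw [split, split]
  refine add_le_add (Finset.sum_le_sum fun j _ => mul_le_mul_of_nonneg_left ?_ (hω j).le)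
    (Finset.sum_le_sum fun i _ => ?_)
  · calc ∑ i, y i j * (g i j - β i)
        = ∑ i', y' i' j * ∑ i, y i j * (g i j - β i) := by
          rw [← Finset.sum_mul, hy'.2.1 j, one_mul]
      _ ≤ ∑ i', y' i' j * ∑ i, y i j * (g i' j - β i') := by
          refine Finset.sum_le_sum fun i' _ => mul_le_mul_of_nonneg_left
            (Finset.sum_le_sum fun i _ => ?_) (hy'.2.2 i' j)
          rcases (hy.2.2 i j).eq_or_lt with h0 | h0
          · rw [← h0, zero_mul, zero_mul]
          · exact mul_le_mul_of_nonneg_left (h.support i j h0 i') h0.le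
      _ = ∑ i', y' i' j * (g i' j - β i') := by
          refine Finset.sum_congr rfl fun i' _ => ?_
          rw [← Finset.sum_mul, hy.2.1 j, one_mul]
  · rcases lt_trichotomy (β i) 0 with hb | hb | hb
    · rw [h.upper i hb]
      exact mul_le_mul_of_nonpos_left (hy'.1 i).2 hb.le
    · rw [hb, zero_mul, zero_mul]
    · rw [h.lower i hb]
      exact mul_le_mul_of_nonneg_left (hy'.1 i).1 hb.le

end WeightBalancedKernelKMeans

/-! ### Counting the cells of a central hyperplane arrangement. -/

namespace WeightBalancedKernelKMeans

/-- The sign patterns of a family of linear functionals on a subspace. -/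
def signPatterns {W ι : Type*} [AddCommGroup W] [Module ℝ W] (f : ι → W →ₗ[ℝ] ℝ)
    (U : Submodule ℝ W) : Set (ι → SignType) :=
  {σ | ∃ w ∈ U, ∀ i, SignType.sign (f i w) = σ i}

/-- A sign pattern that can be extended by two different signs of a further functional is attained
on the kernel of that functional. -/
theorem mem_signPatterns_ker {W ι : Type*} [AddCommGroup W] [Module ℝ W] {f : ι → W →ₗ[ℝ] ℝ}
    {g : W →ₗ[ℝ] ℝ} {U : Submodule ℝ W} {σ : ι → SignType} {w w' : W} (hw : w ∈ U) (hw' : w' ∈ U)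
    (hσ : ∀ i, SignType.sign (f i w) = σ i) (hσ' : ∀ i, SignType.sign (f i w') = σ i)
    (h : SignType.sign (g w) ≠ SignType.sign (g w')) :
    σ ∈ signPatterns f (U ⊓ LinearMap.ker g) := by
  have comb : ∀ {u v : W}, u ∈ U → v ∈ U → (∀ i, SignType.sign (f i u) = σ i) →
      (∀ i, SignType.sign (f i v) = σ i) → g u < 0 → 0 < g v →
      σ ∈ signPatterns f (U ⊓ LinearMap.ker g) := by
    intro u v hu hv hfu hfv hgu hgv
    -- Both weights are positive, so the common signs persist, while the values of `g` cancel.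
    refine ⟨g v • u + (-g u) • v, ⟨U.add_mem (U.smul_mem _ hu) (U.smul_mem _ hv), ?_⟩, fun i => ?_⟩
    · simp only [SetLike.mem_coe, LinearMap.mem_ker, map_add, map_smul, smul_eq_mul]
      ring
    · have h1 := hfu i
      have h2 := hfv i
      simp only [map_add, map_smul, smul_eq_mul]
      rcases hs : σ i
      · rw [hs] at h1 h2
        change _ = (0 : SignType) at h1
        change _ = (0 : SignType) at h2
        rw [sign_eq_zero_iff] at h1 h2
        simp [h1, h2]
      · rw [hs] at h1 h2
        change _ = (-1 : SignType) at h1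
        change _ = (-1 : SignType) at h2
        rw [sign_eq_neg_one_iff] at h1 h2
        exact sign_eq_neg_one_iff.2 (by nlinarith)
      · rw [hs] at h1 h2
        change _ = (1 : SignType) at h1
        change _ = (1 : SignType) at h2
        rw [sign_eq_one_iff] at h1 h2
        exact sign_eq_one_iff.2 (by nlinarith)
  rcases lt_trichotomy (g w) 0 with h1 | h1 | h1
  · rcases lt_trichotomy (g w') 0 with h2 | h2 | h2
    · exact absurd (by rw [sign_neg h1, sign_neg h2]) h
    · exact ⟨w', ⟨hw', h2⟩, hσ'⟩
    · exact comb hw hw' hσ hσ' h1 h2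
  · exact ⟨w, ⟨hw, h1⟩, hσ⟩
  · rcases lt_trichotomy (g w') 0 with h2 | h2 | h2
    · exact comb hw' hw hσ' hσ h2 h1
    · exact ⟨w', ⟨hw', h2⟩, hσ'⟩
    · exact absurd (by rw [sign_pos h1, sign_pos h2]) h

/-- Adding a functional creates at most two new sign patterns for each sign pattern on its
kernel. -/
theorem ncard_signPatterns_succ_le {W : Type*} [AddCommGroup W] [Module ℝ W] {m : ℕ}
    (f : Fin (m + 1) → W →ₗ[ℝ] ℝ) (U : Submodule ℝ W) :
    (signPatterns f U).ncard ≤ (signPatterns (Fin.tail f) U).ncard +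
      2 * (signPatterns (Fin.tail f) (U ⊓ LinearMap.ker (f 0))).ncard := by
  classical
  -- `rot` cycles through the three signs. `ext` selects one attained extension of each pattern; the
  -- two rotations reach the other signs, needed only for patterns that also occur on the kernel.
  let rot : SignType → SignType := fun t => if t = 0 then 1 else if t = 1 then -1 else 0
  have hrot : ∀ t t' : SignType, t' = t ∨ t' = rot t ∨ t' = rot (rot t) := by decide
  let ext : (Fin m → SignType) → SignType := fun σ =>
    if h : ∃ w ∈ U, ∀ i, SignType.sign (Fin.tail f i w) = σ i
      then SignType.sign (f 0 h.choose) else 0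
  set A := signPatterns (Fin.tail f) U
  set B := signPatterns (Fin.tail f) (U ⊓ LinearMap.ker (f 0))
  let F : (SignType → SignType) → (Fin m → SignType) → Fin (m + 1) → SignType :=
    fun c σ => Fin.cons (c (ext σ)) σ
  have hsub : signPatterns f U ⊆ F id '' A ∪ (F rot '' B ∪ F (rot ∘ rot) '' B) := by
    rintro τ ⟨w, hw, hτ⟩
    have hmem : ∃ w ∈ U, ∀ i, SignType.sign (Fin.tail f i w) = Fin.tail τ i :=
      ⟨w, hw, fun i => hτ i.succ⟩
    have hF : ∀ c : SignType → SignType, τ 0 = c (ext (Fin.tail τ)) → F c (Fin.tail τ) = τ := by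
      intro c hc
      change Fin.cons (c (ext (Fin.tail τ))) (Fin.tail τ) = τ
      rw [← hc, Fin.cons_self_tail]
    by_cases hext : τ 0 = ext (Fin.tail τ)
    · exact .inl ⟨_, hmem, hF id hext⟩
    · have hB : Fin.tail τ ∈ B := by
        refine mem_signPatterns_ker hw hmem.choose_spec.1 (fun i => hτ i.succ)
          hmem.choose_spec.2 fun h => hext ?_
        rw [← hτ 0, h]
        simp only [ext, dif_pos hmem]
      rcases hrot (ext (Fin.tail τ)) (τ 0) with h | h | h
      · exact absurd h hext
      · exact .inr (.inl ⟨_, hB, hF rot h⟩)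
      · exact .inr (.inr ⟨_, hB, hF (rot ∘ rot) h⟩)
  have h1 := Set.ncard_le_ncard hsub (Set.toFinite _)
  have h2 := Set.ncard_union_le (F id '' A) (F rot '' B ∪ F (rot ∘ rot) '' B)
  have h3 := Set.ncard_union_le (F rot '' B) (F (rot ∘ rot) '' B)
  have h4 := Set.ncard_image_le (f := F id) (Set.toFinite A)
  have h5 := Set.ncard_image_le (f := F rot) (Set.toFinite B)
  have h6 := Set.ncard_image_le (f := F (rot ∘ rot)) (Set.toFinite B)
  omega

/-- Cells of all dimensions of a central arrangement of `m` hyperplanes: there are at most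
`(2m + 1) ^ N` of them in a space of dimension `N`. -/
theorem ncard_signPatterns_le {W : Type*} [AddCommGroup W] [Module ℝ W] [FiniteDimensional ℝ W] :
    ∀ {m : ℕ} (f : Fin m → W →ₗ[ℝ] ℝ) (U : Submodule ℝ W) {N : ℕ}, Module.finrank ℝ U ≤ N →
      (signPatterns f U).ncard ≤ (2 * m + 1) ^ N
  | 0, f, U, N, _ => by
    simpa using Set.ncard_le_one_of_subsingleton (signPatterns f U)
  | m + 1, f, U, N, hN => by
    -- If `f 0` vanishes on `U`, its sign carries no information; otherwise the kernel loses a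
    -- dimension and the recursion closes through `(2m+1) + 2 = 2(m+1) + 1`.
    by_cases h0 : U ≤ LinearMap.ker (f 0)
    · have hle : (signPatterns f U).ncard ≤ (signPatterns (Fin.tail f) U).ncard := by
        refine Set.ncard_le_ncard_of_injOn Fin.tail ?_ ?_ (Set.toFinite _)
        · rintro σ ⟨w, hw, hσ⟩
          exact ⟨w, hw, fun i => hσ i.succ⟩
        · rintro σ ⟨w, hw, hσ⟩ τ ⟨w', hw', hτ⟩ hστ
          funext i
          refine Fin.cases ?_ (fun i => congrFun hστ i) i
          rw [← hσ, ← hτ, LinearMap.mem_ker.1 (h0 hw), LinearMap.mem_ker.1 (h0 hw')]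
      refine hle.trans ((ncard_signPatterns_le (Fin.tail f) U hN).trans ?_)
      exact Nat.pow_le_pow_left (by omega) N
    · have hlt : U ⊓ LinearMap.ker (f 0) < U := inf_lt_left.2 h0
      have hdim := Submodule.finrank_lt_finrank_of_lt hlt
      obtain ⟨N, rfl⟩ : ∃ N', N = N' + 1 := ⟨N - 1, by omega⟩
      have h1 := ncard_signPatterns_le (Fin.tail f) U hN
      have h2 := ncard_signPatterns_le (Fin.tail f) (U ⊓ LinearMap.ker (f 0)) (N := N) (by omega)
      calc _ ≤ _ := ncard_signPatterns_succ_le f U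
        _ ≤ (2 * m + 1) ^ (N + 1) + 2 * (2 * m + 1) ^ N := by omega
        _ = (2 * m + 1) ^ N * (2 * (m + 1) + 1) := by ring
        _ ≤ (2 * (m + 1) + 1) ^ N * (2 * (m + 1) + 1) :=
          Nat.mul_le_mul_right _ (Nat.pow_le_pow_left (by omega) N)
        _ = _ := (pow_succ _ _).symm

theorem ncard_signPatterns_le_of_fintype {W ι : Type*} [AddCommGroup W] [Module ℝ W]
    [FiniteDimensional ℝ W] [Fintype ι] (f : ι → W →ₗ[ℝ] ℝ) (U : Submodule ℝ W) :
    (signPatterns f U).ncard ≤ (2 * Fintype.card ι + 1) ^ Module.finrank ℝ U := by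
  let e := Fintype.equivFin ι
  refine le_trans ?_ (ncard_signPatterns_le (fun i => f (e.symm i)) U le_rfl)
  refine Set.ncard_le_ncard_of_injOn (fun σ i => σ (e.symm i)) ?_ ?_ (Set.toFinite _)
  · rintro σ ⟨w, hw, hσ⟩
    exact ⟨w, hw, fun i => hσ _⟩
  · intro σ _ τ _ h
    funext i
    simpa using congrFun h (e i)

end WeightBalancedKernelKMeans

/-! ### Sites, reduced costs and the existence of optimal vertices. -/

namespace WeightBalancedKernelKMeans

variable {V : Type*} [NormedAddCommGroup V] [InnerProductSpace ℝ V] {k n : ℕ} {ω : Fin n → ℝ}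
  {κlo κhi : Fin k → ℝ}

/-- The cost coefficients of the objective function for the points `p` and the sites `s`. -/
def siteCost (p : Fin n → V) (s : Fin k → V) (i : Fin k) (j : Fin n) : ℝ :=
  inner ℝ (s i) (s i) - 2 * inner ℝ (p j) (s i)

/-- The centers of gravity are optimal sites for a given assignment. -/
theorem objective_center_le (p : Fin n → V) (s : Fin k → V) {y : Fin k → Fin n → ℝ}
    (hy : ∀ i, 0 < clusterSize ω y i) :
    objective ω p (center ω p y) y ≤ objective ω p s y := by
  refine Finset.sum_le_sum fun i _ => ?_
  have hsum : ∀ v : V, ∑ j, ω j * y i j * (inner ℝ v v - 2 * inner ℝ (p j) v) =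
      clusterSize ω y i * (inner ℝ v v - 2 * inner ℝ (center ω p y i) v) := by
    intro v
    have hc : clusterSize ω y i * inner ℝ (center ω p y i) v =
        ∑ j, ω j * y i j * inner ℝ (p j) v := by
      rw [center, inner_smul_left, conj_trivial, mul_inv_cancel_left₀ (hy i).ne', sum_inner]
      exact Finset.sum_congr rfl fun j _ => by rw [inner_smul_left, conj_trivial, mul_comm (ω j)]
    rw [mul_sub, mul_left_comm, hc, clusterSize, Finset.sum_mul, Finset.mul_sum,
      ← Finset.sum_sub_distrib]
    exact Finset.sum_congr rfl fun j _ => by ring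
  rw [hsum, hsum]
  refine mul_le_mul_of_nonneg_left ?_ (hy i).le
  -- Completing the square: the gap between the two sides is `‖s i - center‖²`.
  have h := real_inner_self_nonneg (x := s i - center ω p y i)
  rw [real_inner_sub_sub_self] at h
  linarith [real_inner_comm (s i) (center ω p y i)]

/-- The difference of the costs of assigning a point to two clusters, as a linear functional of
the sites and the shifts. -/
def costDifference (p : Fin n → V) (q : Fin k × Fin k × Fin n) : (Fin k → V × ℝ) →ₗ[ℝ] ℝ where
  toFun w := ((w q.1).2 - 2 * inner ℝ (p q.2.2) (w q.1).1) -
    ((w q.2.1).2 - 2 * inner ℝ (p q.2.2) (w q.2.1).1)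
  map_add' w w' := by
    simp only [Pi.add_apply, Prod.fst_add, Prod.snd_add, inner_add_right]
    ring
  map_smul' c w := by
    simp only [Pi.smul_apply, Prod.smul_fst, Prod.smul_snd, inner_smul_right, smul_eq_mul,
      RingHom.id_apply]
    ring

/-- The parameters whose shift vanishes at the cluster `i₀`. -/
def normalizedParameters (V : Type*) [NormedAddCommGroup V] [InnerProductSpace ℝ V] (i₀ : Fin k) :
    Submodule ℝ (Fin k → V × ℝ) :=
  LinearMap.ker (LinearMap.snd ℝ V ℝ ∘ₗ LinearMap.proj i₀)

theorem finrank_normalizedParameters_le [FiniteDimensional ℝ V] (i₀ : Fin k) :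
    Module.finrank ℝ (normalizedParameters V i₀) ≤ (Module.finrank ℝ V + 1) * k - 1 := by
  have hne : normalizedParameters V i₀ ≠ ⊤ := by
    intro h
    have : (fun _ => (0, 1) : Fin k → V × ℝ) ∈ normalizedParameters V i₀ := h ▸ Submodule.mem_top
    exact one_ne_zero (α := ℝ) this
  have h := Submodule.finrank_lt hne
  rw [Module.finrank_pi_fintype] at h
  simp only [Module.finrank_prod, Module.finrank_self, Finset.sum_const, Finset.card_univ,
    Fintype.card_fin, smul_eq_mul] at h
  rw [mul_comm]
  omega

/-- The signs of the differences of the reduced costs. -/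
noncomputable def reducedCostSigns (p : Fin n → V) (s : Fin k → V) (β : Fin k → ℝ)
    (q : Fin k × Fin k × Fin n) : SignType :=
  SignType.sign ((siteCost p s q.1 q.2.2 - β q.1) - (siteCost p s q.2.1 q.2.2 - β q.2.1))

/-- The second coordinate absorbs both the quadratic term and the multiplier; subtracting its value
at `i₀` from every cluster leaves all differences unchanged. -/
theorem reducedCostSigns_mem (i₀ : Fin k) (p : Fin n → V) (s : Fin k → V) (β : Fin k → ℝ) :
    reducedCostSigns p s β ∈ signPatterns (costDifference p) (normalizedParameters V i₀) := by
  refine ⟨fun i => (s i, inner ℝ (s i) (s i) - β i - (inner ℝ (s i₀) (s i₀) - β i₀)), ?_, ?_⟩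
  · exact sub_self (inner ℝ (s i₀) (s i₀) - β i₀)
  · intro q
    unfold reducedCostSigns
    congr 1
    simp only [costDifference, siteCost, LinearMap.coe_mk, AddHom.coe_mk]
    ring

/-- Complementary slackness depends only on the signs of the reduced costs and multipliers. -/
theorem IsComplementary.congr {p : Fin n → V} {s s' : Fin k → V} {β β' : Fin k → ℝ}
    {y : Fin k → Fin n → ℝ} (h : IsComplementary ω κlo κhi (siteCost p s) β y)
    (hcost : reducedCostSigns p s β = reducedCostSigns p s' β')
    (hβ : ∀ i, SignType.sign (β i) = SignType.sign (β' i)) :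
    IsComplementary ω κlo κhi (siteCost p s') β' y := by
  refine ⟨fun i j hij i' => ?_, fun i hi => h.lower i ?_, fun i hi => h.upper i ?_⟩
  · by_contra hlt
    have h1 : reducedCostSigns p s' β' (i, i', j) = 1 :=
      sign_eq_one_iff.2 (sub_pos.2 (not_le.1 hlt))
    rw [← hcost] at h1
    exact absurd (h.support i j hij i') (not_le.2 (sub_pos.1 (sign_eq_one_iff.1 h1)))
  · exact sign_eq_one_iff.1 ((hβ i).trans (sign_pos hi))
  · exact sign_eq_neg_one_iff.1 ((hβ i).trans (sign_neg hi))

theorem partitionPolytope_nonempty (hn : 0 < n) (hω : ∀ j, 0 < ω j)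
    (hκlo : ∀ i, 0 < κlo i) (hκ : ∀ i, κlo i ≤ κhi i)
    (hlo : ∑ i, κlo i ≤ ∑ j, ω j) (hhi : ∑ j, ω j ≤ ∑ i, κhi i) :
    (partitionPolytope ω κlo κhi).Nonempty := by
  have hpos : 0 < ∑ j, ω j := Finset.sum_pos (fun j _ => hω j) ⟨⟨0, hn⟩, Finset.mem_univ _⟩
  obtain ⟨t, ht0, ht1, ht⟩ : ∃ t : ℝ, 0 ≤ t ∧ t ≤ 1 ∧
      t * (∑ i, κhi i - ∑ i, κlo i) = ∑ j, ω j - ∑ i, κlo i := by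
    rcases (hlo.trans hhi).eq_or_lt with h | h
    · exact ⟨0, le_rfl, zero_le_one, by linarith⟩
    · have hD : 0 < ∑ i, κhi i - ∑ i, κlo i := sub_pos.2 h
      exact ⟨(∑ j, ω j - ∑ i, κlo i) / (∑ i, κhi i - ∑ i, κlo i),
        div_nonneg (sub_nonneg.2 hlo) hD.le, (div_le_one hD).2 (by linarith),
        div_mul_cancel₀ _ hD.ne'⟩
  -- Interpolate between the bounds until the sizes add up to the total weight, then split every
  -- point in these proportions.
  let size : Fin k → ℝ := fun i => κlo i + t * (κhi i - κlo i)
  have hsize : ∑ i, size i = ∑ j, ω j := by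
    simp only [size, Finset.sum_add_distrib, ← Finset.mul_sum, Finset.sum_sub_distrib]
    linarith
  have hstep : ∀ i, 0 ≤ t * (κhi i - κlo i) := fun i => mul_nonneg ht0 (sub_nonneg.2 (hκ i))
  refine ⟨fun i _ => size i / ∑ j, ω j, fun i => ?_, fun j => ?_, fun i j => ?_⟩
  · have hc : clusterSize ω (fun i _ => size i / ∑ j, ω j) i = size i := by
      rw [clusterSize, ← Finset.mul_sum, div_mul_cancel₀ _ hpos.ne']
    rw [hc]
    have := mul_le_of_le_one_left (sub_nonneg.2 (hκ i)) ht1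
    exact ⟨by linarith [hstep i], by linarith⟩
  · rw [← Finset.sum_div, hsize, div_self hpos.ne']
  · exact div_nonneg (add_nonneg (hκlo i).le (hstep i)) hpos.le

theorem isCompact_partitionPolytope : IsCompact (partitionPolytope ω κlo κhi) := by
  refine (isCompact_Icc (a := (0 : Fin k → Fin n → ℝ)) (b := 1)).of_isClosed_subset ?_ ?_
  · simp only [partitionPolytope, clusterSize, Set.ofPred_and, Set.ofPred_forall]
    refine IsClosed.inter ?_ (IsClosed.inter ?_ ?_)
    · exact isClosed_iInter fun i => (isClosed_le (by fun_prop) (by fun_prop)).inter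
        (isClosed_le (by fun_prop) (by fun_prop))
    · exact isClosed_iInter fun j => isClosed_eq (by fun_prop) (by fun_prop)
    · exact isClosed_iInter fun i => isClosed_iInter fun j =>
        isClosed_le (by fun_prop) (by fun_prop)
  · intro y hy
    refine ⟨fun i j => hy.2.2 i j, fun i j => ?_⟩
    change y i j ≤ 1
    rw [← hy.2.1 j]
    exact Finset.single_le_sum (f := fun i => y i j) (fun i _ => hy.2.2 i j) (Finset.mem_univ i)

/-- The minimizers form a nonempty compact exposed face; an extreme point of it is also a vertex of
the polytope. -/
theorem exists_isAssignment (hne : (partitionPolytope ω κlo κhi).Nonempty) (p : Fin n → V)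
    (s : Fin k → V) : ∃ y, IsAssignment ω κlo κhi p s y := by
  let c : StrongDual ℝ (Fin k → Fin n → ℝ) :=
    LinearMap.toContinuousLinearMap (-costLinear ω (siteCost p s))
  have hexp : IsExposed ℝ (partitionPolytope ω κlo κhi)
      (c.toExposed (partitionPolytope ω κlo κhi)) :=
    ContinuousLinearMap.toExposed.isExposed
  have hcomp := isCompact_partitionPolytope (ω := ω) (κlo := κlo) (κhi := κhi)
  obtain ⟨z, hz, hmax⟩ := hcomp.exists_isMaxOn hne c.continuous.continuousOn
  obtain ⟨y, hy⟩ := (hexp.isCompact hcomp).extremePoints_nonempty ⟨z, hz, fun y hy => hmax hy⟩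
  refine ⟨y, hexp.isExtreme.extremePoints_subset_extremePoints hy, fun y' hy' => ?_⟩
  exact neg_le_neg_iff.1 (hy.1.2 y' hy')

/-! ### Executions: counting iterations and continuing a run. -/

variable {d : ℕ} {φ : EuclideanSpace ℝ (Fin d) → V} {x : Fin n → EuclideanSpace ℝ (Fin d)}
  {s : Fin k → EuclideanSpace ℝ (Fin d)} {T : ℕ} {S : ℕ → Fin k → V} {y : ℕ → Fin k → Fin n → ℝ}

theorem IsExecution.mem (h : IsExecution ω κlo κhi φ x s T S y) {l : ℕ} (hl : l < T) :
    y l ∈ partitionPolytope ω κlo κhi :=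
  (h.assign l hl).vertex.1

theorem IsExecution.objective_lt (h : IsExecution ω κlo κhi φ x s T S y) {l m : ℕ} (hlm : l < m)
    (hm : m + 1 < T) :
    objective ω (fun j => φ (x j)) (S m) (y m) < objective ω (fun j => φ (x j)) (S l) (y l) := by
  induction m, hlm using Nat.le_induction with
  | base => exact h.goOn l hm
  | succ m hlm ih => exact (h.goOn m hm).trans (ih (by omega))

/-- The assignment of an iteration is no longer optimal two or more iterations later. -/
theorem IsExecution.not_optimal (h : IsExecution ω κlo κhi φ x s T S y) (hκlo : ∀ i, 0 < κlo i)
    {l m : ℕ} (hlm : l + 1 < m) (hm : m + 1 < T) :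
    ¬ ∀ y' ∈ partitionPolytope ω κlo κhi, objective ω (fun j => φ (x j)) (S m) (y l) ≤
      objective ω (fun j => φ (x j)) (S m) y' := by
  intro hopt
  have hl := h.mem (l := l) (by omega)
  have hS : S (l + 1) = center ω (fun j => φ (x j)) (y l) := funext (h.update l (by omega))
  have h1 := h.objective_lt hlm hm
  have h2 := (h.assign (l + 1) (by omega)).optimal _ hl
  have h3 := objective_center_le (fun j => φ (x j)) (S m) fun i =>
    (hκlo i).trans_le (hl.1 i).1
  rw [← hS] at h3
  have h4 := hopt _ (h.mem (l := m) (by omega))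
  -- With `f a b` the objective at `S a`, `y b`: `f m m < f (l+1) (l+1) ≤ f (l+1) l ≤ f m l ≤ f m
  -- m`.
  linarith

/-- Even iterations are at least two apart, as `not_optimal` requires: between consecutive
iterations the decrease may come from the site update alone. Indices `l < T / 2` also give `2 * l +
1 < T`, which avoids the last iteration, where no decrease is guaranteed. -/
theorem IsExecution.half_le [FiniteDimensional ℝ V] (h : IsExecution ω κlo κhi φ x s T S y)
    (hk : 0 < k) (hω : ∀ j, 0 < ω j) (hκlo : ∀ i, 0 < κlo i) :
    T / 2 ≤ (2 * (k * (k * n)) + 1) ^ ((Module.finrank ℝ V + 1) * k - 1) * 3 ^ k := by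
  classical
  have hdual : ∀ l : Fin (T / 2), ∃ β,
      IsComplementary ω κlo κhi (siteCost (fun j => φ (x j)) (S (2 * l))) β (y (2 * l)) :=
    fun l => exists_isComplementary hω (h.mem (by omega)) (h.assign (2 * l) (by omega)).optimal
  choose β hβ using hdual
  let P := signPatterns (costDifference fun j => φ (x j)) (normalizedParameters V (⟨0, hk⟩ : Fin k))
  let F : Fin (T / 2) → P × (Fin k → SignType) := fun l =>
    (⟨_, reducedCostSigns_mem ⟨0, hk⟩ (fun j => φ (x j)) (S (2 * l)) (β l)⟩,
      fun i => SignType.sign (β l i))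
  have hlt : ∀ l m, l < m → F l ≠ F m := by
    intro l m hlm hF
    have h1 := congrArg Subtype.val (congrArg Prod.fst hF)
    have h2 := congrFun (congrArg Prod.snd hF)
    have hlm' : (l : ℕ) < m := hlm
    refine h.not_optimal hκlo (l := 2 * l) (m := 2 * m) (by omega) (by omega) fun y' hy' => ?_
    exact ((hβ l).congr h1 h2).costLinear_le hω (h.mem (by omega)) hy'
  have hinj : Function.Injective F := by
    intro l m hF
    rcases lt_trichotomy l m with hlm | hlm | hlm
    · exact absurd hF (hlt l m hlm)
    · exact hlm
    · exact absurd hF.symm (hlt m l hlm)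
  have hcard := Nat.card_le_card_of_injective F hinj
  rw [Nat.card_prod, Nat.card_fin, Nat.card_fun, Nat.card_coe_set_eq] at hcard
  have h3 : Nat.card SignType = 3 := by rw [Nat.card_eq_fintype_card]; rfl
  rw [h3, Nat.card_fin] at hcard
  refine hcard.trans (Nat.mul_le_mul_right _ ?_)
  refine (ncard_signPatterns_le_of_fintype _ _).trans ?_
  simp only [Fintype.card_prod, Fintype.card_fin]
  exact Nat.pow_le_pow_right (by omega) (finrank_normalizedParameters_le _)

theorem iteration_bound_arith {k n N T : ℕ} (hk : 2 ≤ k) (hn : 1 ≤ n) (hN : k - 1 ≤ N)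
    (h : T / 2 ≤ (2 * (k * (k * n)) + 1) ^ N * 3 ^ k) :
    (T : ℝ) ≤ (40 * Real.exp 1 * (k : ℝ) ^ 2 * (n : ℝ)) ^ N := by
  have hkn : 1 ≤ k * (k * n) := Nat.mul_pos (by omega) (Nat.mul_pos (by omega) hn)
  have hT : T ≤ (81 * (k * (k * n))) ^ N := by
    calc T ≤ 2 * (T / 2) + 1 := by omega
      _ ≤ 2 * ((2 * (k * (k * n)) + 1) ^ N * 3 ^ k) + 1 := by omega
      _ ≤ 3 * ((2 * (k * (k * n)) + 1) ^ N * 3 ^ k) := by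
        have : 0 < (2 * (k * (k * n)) + 1) ^ N * 3 ^ k := by positivity
        omega
      _ = (2 * (k * (k * n)) + 1) ^ N * 3 ^ (k + 1) := by ring
      -- `k + 1 ≤ 3 * (k - 1) ≤ 3 * N` uses `k ≥ 2`; the resulting constant `81 = 3 * 27` lies below
      -- `40 * e`.
      _ ≤ (3 * (k * (k * n))) ^ N * 3 ^ (3 * N) := Nat.mul_le_mul
        (Nat.pow_le_pow_left (by omega) N) (Nat.pow_le_pow_right (by omega) (by omega))
      _ = (81 * (k * (k * n))) ^ N := by
        rw [pow_mul, ← mul_pow]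
        congr 1
        ring
  have he : 81 ≤ 40 * Real.exp 1 := by linarith [Real.exp_one_gt_d9]
  calc (T : ℝ) ≤ ((81 * (k * (k * n)) : ℕ) : ℝ) ^ N := by exact_mod_cast hT
    _ ≤ _ := by
      refine pow_le_pow_left₀ (by positivity) ?_ N
      push_cast
      have : (0 : ℝ) ≤ k * (k * n) := by positivity
      nlinarith

/-- An execution that has not returned can be continued. -/
theorem IsExecution.exists_succ (h : IsExecution ω κlo κhi φ x s T S y)
    (hne : (partitionPolytope ω κlo κhi).Nonempty)
    (hret : ¬ HasReturned ω (fun j => φ (x j)) T S y) :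
    ∃ (S' : ℕ → Fin k → V) (y' : ℕ → Fin k → Fin n → ℝ),
      IsExecution ω κlo κhi φ x s (T + 1) S' y' ∧ ∀ l < T, S' l = S l ∧ y' l = y l := by
  obtain ⟨z, hz⟩ := exists_isAssignment hne (fun j => φ (x j)) (S T)
  let S' := Function.update S (T + 1) (center ω (fun j => φ (x j)) z)
  let y' := Function.update y T z
  have hS : ∀ l ≤ T, S' l = S l := fun l hl => Function.update_of_ne (by omega) _ _
  have hy : ∀ l < T, y' l = y l := fun l hl => Function.update_of_ne hl.ne _ _
  have hyT : y' T = z := Function.update_self _ _ _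
  have hST : S' (T + 1) = center ω (fun j => φ (x j)) z := Function.update_self _ _ _
  refine ⟨S', y', ⟨fun i => ?_, fun l hl => ?_, fun l hl i => ?_, fun l hl => ?_⟩,
    fun l hl => ⟨hS l hl.le, hy l hl⟩⟩
  · rw [hS 0 (Nat.zero_le T)]
    exact h.1 i
  · rcases (Nat.lt_succ_iff.1 hl).eq_or_lt with rfl | hl
    · rw [hS l le_rfl, hyT]
      exact hz
    · rw [hS l hl.le, hy l hl]
      exact h.assign l hl
  · rcases (Nat.lt_succ_iff.1 hl).eq_or_lt with rfl | hl
    · rw [hST, hyT]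
    · rw [hS (l + 1) hl, hy l hl]
      exact h.update l hl i
  · rw [hS l (by omega), hS (l + 1) (by omega), hy l (by omega), hy (l + 1) (by omega)]
    by_contra hlt
    -- Only the comparison of the last two recorded iterations is new; its failure would mean that
    -- the run had returned.
    rcases (show l + 2 ≤ T by omega).eq_or_lt with hT | hT
    · exact hret ⟨l, hT.symm, hlt⟩
    · exact hlt (h.goOn l hT)

end WeightBalancedKernelKMeans

theorem corollary6p1 {V : Type*} [NormedAddCommGroup V] [InnerProductSpace ℝ V]
    [FiniteDimensional ℝ V] (k n d : ℕ) (hk : 2 ≤ k) (hn : k ≤ n)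
    (x : Fin n → EuclideanSpace ℝ (Fin d)) (hx : Function.Injective x)
    (ω : Fin n → ℝ) (hω : ∀ j, 0 < ω j)
    (κlo κhi : Fin k → ℝ) (hκlo : ∀ i, 0 < κlo i) (hκ : ∀ i, κlo i ≤ κhi i)
    (hlo : ∑ i, κlo i ≤ ∑ j, ω j) (hhi : ∑ j, ω j ≤ ∑ i, κhi i)
    (φ : EuclideanSpace ℝ (Fin d) → V) (s : Fin k → EuclideanSpace ℝ (Fin d))
    (T : ℕ) (S : ℕ → Fin k → V) (y : ℕ → Fin k → Fin n → ℝ)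
    (hrun : WeightBalancedKernelKMeans.IsExecution ω κlo κhi φ x s T S y) :
    -- no execution performs more iterations than the bound
    (T : ℝ) ≤ (40 * Real.exp 1 * (k : ℝ) ^ 2 * (n : ℝ)) ^ ((Module.finrank ℝ V + 1) * k - 1) ∧
    -- and an execution never gets stuck: it has returned, or the next iteration can be performed
    (WeightBalancedKernelKMeans.HasReturned ω (fun j => φ (x j)) T S y ∨
      ∃ (S' : ℕ → Fin k → V) (y' : ℕ → Fin k → Fin n → ℝ),
        WeightBalancedKernelKMeans.IsExecution ω κlo κhi φ x s (T + 1) S' y' ∧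
        ∀ l < T, S' l = S l ∧ y' l = y l) := by
  refine ⟨?_, ?_⟩
  · refine WeightBalancedKernelKMeans.iteration_bound_arith hk (by omega) ?_
      (hrun.half_le (by omega) hω hκlo)
    exact Nat.sub_le_sub_right (Nat.le_mul_of_pos_left k (Nat.succ_pos _)) 1
  · exact or_iff_not_imp_left.2 fun hret => hrun.exists_succ
      (WeightBalancedKernelKMeans.partitionPolytope_nonempty (by omega) hω hκlo hκ hlo hhi) hret
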